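/- For a finitely generated group $G$ and $p$ equal to $0$ or a prime, let $m_p(G)$ denote the minimum dimension $d$ such that there is an injective homomorphism $G\hookrightarrow GL(d,\mathbb F)$ for some field $\mathbb F$ of characteristic $p$ (with $m_p(G)=\infty$ if there is no such homomorphism for any $d$). Let $F_2$ be the free group on $x,y$, let $\alpha$ be the automorphism of $F_2$ with $\alpha(x)=x$ and $\alpha(y)=yx$, and let $G=F_2\rtimes_\alpha\mathbb Z$ be the semidirect product in which the generator $1\in\mathbb Z$ acts on $F_2$ as $\alpha$. Then, for every $p$ equal to $0$ or a prime, $$3\le m_p(G)\le 6 .$$ -/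

import Mathlib

universe u v

/-- `G` has a faithful linear representation of dimension `d` over some field of
characteristic `p`: an injective homomorphism into `GL(d, F)`. -/
def HasFaithfulRepOfDim (p : ℕ) (G : Type v) [Group G] (d : ℕ) : Prop :=
  ∃ (F : Type u) (_ : Field F) (_ : CharP F p) (ρ : G →* Matrix.GeneralLinearGroup (Fin d) F),
    Function.Injective ρ

/-- `m_p(G)`: the minimum dimension of a faithful linear representation of `G` over all fields
(in the universe `u`) of characteristic `p`, and `⊤` if there is no such representation. -/
noncomputable def minFaithfulDim (p : ℕ) (G : Type v) [Group G] : ℕ∞ :=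
  sInf {m : ℕ∞ | ∃ d : ℕ, m = (d : ℕ∞) ∧ HasFaithfulRepOfDim.{u, v} p G d}

namespace FreeByCyclic

/-- The free group of rank two. -/
abbrev F₂ : Type := FreeGroup (Fin 2)

/-- The first free generator. -/
def x : F₂ := FreeGroup.of 0

/-- The second free generator. -/
def y : F₂ := FreeGroup.of 1

/-- The automorphism `α` of `F₂` with `α x = x` and `α y = y x`; its inverse sends `x` to `x`
and `y` to `y x⁻¹`. -/
def α : MulAut F₂ :=
  MonoidHom.toMulEquiv (FreeGroup.lift ![x, y * x]) (FreeGroup.lift ![x, y * x⁻¹])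
    (by ext i; fin_cases i <;> simp [x, y])
    (by ext i; fin_cases i <;> simp [x, y])

theorem α_x : α x = x := by simp [α, x]

theorem α_y : α y = y * x := by simp [α, x, y]

/-- The semidirect product `F₂ ⋊_α ℤ`, where `n : ℤ` acts on `F₂` as `α ^ n`. -/
abbrev G : Type := F₂ ⋊[zpowersHom (MulAut F₂) α] Multiplicative ℤ

end FreeByCyclic

/-! Lower bound: `α` fixes `x` and `y * x * y⁻¹`, so both commute with the stable letter `gt`, which
is not central; but they do not commute with each other, whereas in size at most two the centralizer
of a non-scalar matrix is commutative. Upper bound: dimension 3 already suffices. Diagonal `matX`,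
`matT` and a matrix `matY` conjugating `matX * matT` to `matT` satisfy the relations of `G`.
Faithfulness only needs checking on `F₂`, where it follows from non-archimedean ping-pong over
`k(l)(z)`, with `z` large and every `l ^ n - 1`, `n ≠ 0`, of valuation 1. -/

open Matrix in
/-- Two square matrices of size at most two that commute with a matrix which is not central
commute with each other. -/
theorem commute_of_commute_of_not_central {F : Type*} [Field F] {d : ℕ} (hd : d < 3)
    {A B C D : Matrix (Fin d) (Fin d) F} (hA : A * B = B * A) (hC : C * B = B * C)
    (hD : D * B ≠ B * D) : A * C = C * A := by
  interval_cases d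
  · exact Subsingleton.elim _ _
  · ext i j
    fin_cases i; fin_cases j
    simp [Matrix.mul_apply, mul_comm]
  · simp only [← Matrix.ext_iff, Fin.forall_fin_two, Matrix.mul_apply, Fin.sum_univ_two, ne_eq]
      at hA hC hD ⊢
    obtain ⟨⟨a1, a2⟩, a3, a4⟩ := hA
    obtain ⟨⟨c1, c2⟩, c3, c4⟩ := hC
    -- A non-scalar `B` has a nonzero off-diagonal entry or distinct diagonal entries; multiplying
    -- by that nonzero quantity reduces the goal to the commutation equations.
    by_cases h1 : B 0 1 = 0
    · by_cases h2 : B 1 0 = 0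
      · by_cases h3 : B 0 0 - B 1 1 = 0
        · exfalso
          apply hD
          rw [h1, h2, sub_eq_zero.mp h3]
          refine ⟨⟨?_, ?_⟩, ?_, ?_⟩ <;> ring
        · refine ⟨⟨?_, ?_⟩, ?_, ?_⟩ <;> apply mul_left_cancel₀ h3 <;> grind
      · refine ⟨⟨?_, ?_⟩, ?_, ?_⟩ <;> apply mul_left_cancel₀ h2 <;> grind
    · refine ⟨⟨?_, ?_⟩, ?_, ?_⟩ <;> apply mul_left_cancel₀ h1 <;> grind

open Function in
/-- Ping-pong for the powers of the images of the free generators. -/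
theorem FreeGroup.injective_lift_of_zpow_ping_pong {ι G S : Type*} [Nontrivial ι] [Group G]
    [MulAction G S] (a : ι → G) (X : ι → Set S) (hne : ∀ i, (X i).Nonempty)
    (hdisj : Pairwise fun i j => Disjoint (X i) (X j))
    (hpp : ∀ i j, i ≠ j → ∀ n : ℤ, n ≠ 0 → ∀ s ∈ X j, a i ^ n • s ∈ X i) :
    Injective (FreeGroup.lift a) := by
  have hlift : FreeGroup.lift a =
      (Monoid.CoprodI.lift fun i => FreeGroup.lift fun _ : Unit => a i).comp
        (freeGroupEquivCoprodI (ι := ι)).toMonoidHom := by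
    ext i
    simp
  rw [hlift, MonoidHom.coe_comp]
  refine Injective.comp ?_ (MulEquiv.injective freeGroupEquivCoprodI)
  refine Monoid.CoprodI.lift_injective_of_ping_pong (fun i => FreeGroup.lift fun _ : Unit => a i)
    ?_ X hne hdisj ?_
  -- With possibly only two factors, ping-pong needs one with at least three elements; here each is
  -- infinite cyclic.
  · obtain ⟨i⟩ : Nonempty ι := inferInstance
    exact Or.inr ⟨i, (Cardinal.natCast_lt_aleph0 (n := 3)).le.trans
      (Cardinal.infinite_iff.mp inferInstance)⟩
  · intro i j hij h hh
    obtain ⟨n, rfl⟩ := freeGroupUnitEquivInt.symm.surjective h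
    have hn : n ≠ 0 := by
      rintro rfl
      exact hh rfl
    rintro _ ⟨s, hs, rfl⟩
    have := hpp i j hij n hn s hs
    simpa [freeGroupUnitEquivInt] using this

namespace FreeByCyclic

open SemidirectProduct

/-- The element `x` of `G`. -/
abbrev gx : G := inl x

/-- The element `y` of `G`. -/
abbrev gy : G := inl y

/-- The stable letter, acting on `F₂` as `α`. -/
abbrev gt : G := inr (Multiplicative.ofAdd 1)

theorem gt_mul_inl (w : F₂) : gt * inl w = inl (α w) * gt := by
  have := inl_aut (φ := zpowersHom (MulAut F₂) α) (Multiplicative.ofAdd 1) w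
  simp only [zpowersHom_apply, toAdd_ofAdd, zpow_one] at this
  rw [this]
  simp [gt, mul_assoc]

/-! ### Lower bound -/

theorem three_le_of_hasFaithfulRepOfDim {p d : ℕ} (h : HasFaithfulRepOfDim.{u, 0} p G d) :
    3 ≤ d := by
  by_contra! hd
  obtain ⟨F, _, _, ρ, hρ⟩ := h
  have key {a b : G} : a * b = b * a ↔
      (ρ a : Matrix (Fin d) (Fin d) F) * (ρ b : Matrix (Fin d) (Fin d) F) =
      (ρ b : Matrix (Fin d) (Fin d) F) * (ρ a : Matrix (Fin d) (Fin d) F) := by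
    rw [← Units.val_mul, ← Units.val_mul, Units.val_inj, ← map_mul, ← map_mul, hρ.eq_iff]
  have h1 : gx * gt = gt * gx := by rw [gt_mul_inl, α_x]
  have h2 : inl (y * x * y⁻¹) * gt = gt * inl (y * x * y⁻¹) := by
    rw [gt_mul_inl]; simp [α_x, α_y]
  have h3 : gy * gt ≠ gt * gy := by
    rw [gt_mul_inl, α_y]
    intro h
    have := inl_injective (mul_right_cancel h)
    simp [x, FreeGroup.of_ne_one] at this
  have h4 : gx * inl (y * x * y⁻¹) ≠ inl (y * x * y⁻¹) * gx := by
    rw [← map_mul, ← map_mul, inl_injective.ne_iff]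
    decide
  rw [Ne, key] at h3 h4
  rw [key] at h1 h2
  exact h4 (commute_of_commute_of_not_central hd h1 h2 h3)

/-! ### Representations of `G` and their restriction to `F₂` -/

/-- The exponent sum of `x`. -/
def xExp : F₂ →* Multiplicative ℤ := FreeGroup.lift ![Multiplicative.ofAdd 1, 1]

theorem α_zpow_x (n : ℤ) : (α ^ n) x = x := by
  have : α ∈ MulAction.stabilizer (MulAut F₂) x := α_x
  exact zpow_mem this n

theorem α_zpow_y (n : ℤ) : (α ^ n) y = y * x ^ n := by
  induction n with
  | zero => simp
  | succ n ih =>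
    rw [add_comm, zpow_add, MulAut.mul_apply, ih]
    simp [α_x, α_y, zpow_add, mul_assoc]
  | pred n ih =>
    apply α.injective
    rw [← MulAut.mul_apply, ← zpow_one_add, add_sub_cancel, ih, map_mul, map_zpow, α_x, α_y,
      mul_assoc, ← zpow_one_add, add_sub_cancel]

/-- A homomorphism from `G` is injective as soon as its restriction to `F₂` is. -/
theorem injective_of_injective_comp_inl {H : Type*} [Group H] (ρ : G →* H)
    (h : Function.Injective (ρ.comp inl)) : Function.Injective ρ := by
  rw [injective_iff_map_eq_one]
  intro g hg
  -- Conjugation by a kernel element is invisible under `ρ`, hence trivial on `F₂`.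
  have hconj (f : F₂) : g.left * (α ^ g.right.toAdd) f * g.left⁻¹ = f := by
    apply h
    have : inl (g.left * (α ^ g.right.toAdd) f * g.left⁻¹) = g * inl f * g⁻¹ := by
      ext <;> simp
    rw [MonoidHom.comp_apply, MonoidHom.comp_apply, this, map_mul, map_mul, map_inv, hg]
    simp
  have hr : g.right = 1 := by
    -- The exponent sum of `x` is `g.right` on the left and 0 on the right.
    have := congrArg xExp (hconj y)
    rw [α_zpow_y] at this
    simpa [xExp, x, y] using this
  have hg' : g = inl g.left := by ext <;> simp [hr]
  rw [hg'] at hg ⊢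
  rw [h (a₁ := g.left) (a₂ := 1) (by simpa using hg), map_one]

/-- The homomorphism from `G` given by elements satisfying its defining relations. -/
def repOf {H : Type*} [Group H] (X Y T : H) (hX : T * X = X * T) (hY : T * Y = Y * X * T) :
    G →* H :=
  SemidirectProduct.lift (FreeGroup.lift ![X, Y]) (zpowersHom H T) <| by
    intro g
    -- Compatible pairs form a subgroup, so compatibility of `(α, T)` passes to all its powers.
    let S : Subgroup (MulAut F₂ × H) :=
      { carrier := {q | ∀ w, FreeGroup.lift ![X, Y] (q.1 w) =
          q.2 * FreeGroup.lift ![X, Y] w * q.2⁻¹}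
        mul_mem' := by
          intro a b ha hb w
          simp only [Prod.fst_mul, Prod.snd_mul, MulAut.mul_apply]
          rw [ha, hb]; group
        one_mem' := by intro w; simp
        inv_mem' := by
          intro a ha w
          have := ha (a.1⁻¹ w)
          simp only [MulAut.apply_inv_self] at this
          simp only [Prod.fst_inv, Prod.snd_inv]
          rw [this]; group }
    have hS : (α, T) ∈ S := by
      intro w
      refine DFunLike.congr_fun (f := (FreeGroup.lift ![X, Y]).comp α.toMonoidHom)
        (g := (MulAut.conj T).toMonoidHom.comp (FreeGroup.lift ![X, Y])) ?_ w
      ext i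
      fin_cases i
      · have : α (FreeGroup.of 0) = x := α_x
        simp [this, x, hX]
      · have : α (FreeGroup.of 1) = y * x := α_y
        simp [this, x, y, hY]
    have := zpow_mem hS g.toAdd
    ext i
    exact this (FreeGroup.of i)

theorem repOf_comp_inl {H : Type*} [Group H] (X Y T : H) (hX : T * X = X * T)
    (hY : T * Y = Y * X * T) : (repOf X Y T hX hY).comp inl = FreeGroup.lift ![X, Y] :=
  lift_comp_inl ..

/-! ### Ping-pong in dimension three -/

section PingPong

variable {K Γ : Type*} [Field K] [LinearOrderedCommGroupWithZero Γ]

open Matrix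

/-- The diagonal matrix with entries `l⁻¹, l, 1`. -/
def matX (l : Kˣ) : GL (Fin 3) K :=
  ⟨!![(l⁻¹ : K), 0, 0; 0, (l : K), 0; 0, 0, 1], !![(l : K), 0, 0; 0, (l⁻¹ : K), 0; 0, 0, 1],
    by ext i j; fin_cases i <;> fin_cases j <;> simp [Matrix.mul_apply, Fin.sum_univ_three],
    by ext i j; fin_cases i <;> fin_cases j <;> simp [Matrix.mul_apply, Fin.sum_univ_three]⟩

/-- The diagonal matrix with entries `1, l⁻¹, 1`. -/
def matT (l : Kˣ) : GL (Fin 3) K :=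
  ⟨!![1, 0, 0; 0, (l⁻¹ : K), 0; 0, 0, 1], !![1, 0, 0; 0, (l : K), 0; 0, 0, 1],
    by ext i j; fin_cases i <;> fin_cases j <;> simp [Matrix.mul_apply, Fin.sum_univ_three],
    by ext i j; fin_cases i <;> fin_cases j <;> simp [Matrix.mul_apply, Fin.sum_univ_three]⟩

/-- A matrix mapping the `l⁻¹`-eigenvector of `matT l` to that of `matX l * matT l`, which is
expanding in the direction of `(1, 0, 1)` when `z` is large. -/
def matY (z : Kˣ) : GL (Fin 3) K :=
  ⟨!![0, (z : K), (z⁻¹ : K) - z; 1, 0, 0; 0, (z : K), -z],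
    !![0, 1, 0; (z : K), 0, (z⁻¹ : K) - z; (z : K), 0, -z],
    by ext i j; fin_cases i <;> fin_cases j <;>
      simp [Matrix.mul_apply, Fin.sum_univ_three, mul_sub, sub_mul],
    by ext i j; fin_cases i <;> fin_cases j <;>
      simp [Matrix.mul_apply, Fin.sum_univ_three, mul_sub, sub_mul]⟩

theorem matT_mul_matX (l : Kˣ) : matT l * matX l = matX l * matT l := by
  ext i j
  fin_cases i <;> fin_cases j <;> simp [matT, matX, Matrix.mul_apply, Fin.sum_univ_three]

theorem matT_mul_matY (l z : Kˣ) : matT l * matY z = matY z * matX l * matT l := by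
  ext i j
  fin_cases i <;> fin_cases j <;> simp [matT, matX, matY, Matrix.mul_apply, Fin.sum_univ_three]

theorem matX_zpow (l : Kˣ) (n : ℤ) : matX l ^ n = matX (l ^ n) := by
  let f : Kˣ →* GL (Fin 3) K := MonoidHom.mk' matX fun a b => by
    ext i j
    fin_cases i <;> fin_cases j <;> simp [matX, Matrix.mul_apply, Fin.sum_univ_three, mul_comm]
  exact (map_zpow f l n).symm

theorem matX_smul (l : Kˣ) (u : Fin 3 → K) :
    matX l • u = ![(l⁻¹ : K) * u 0, (l : K) * u 1, u 2] := by
  change (matX l : Matrix (Fin 3) (Fin 3) K) *ᵥ u = _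
  ext i
  fin_cases i <;> simp [matX, Matrix.mulVec, dotProduct, Fin.sum_univ_three]

theorem matY_smul (z : Kˣ) (u : Fin 3 → K) :
    matY z • u = ![z * (u 1 - u 2) + (z⁻¹ : K) * u 2, u 0, z * (u 1 - u 2)] := by
  change (matY z : Matrix (Fin 3) (Fin 3) K) *ᵥ u = _
  ext i
  fin_cases i <;> simp [matY, Matrix.mulVec, dotProduct, Fin.sum_univ_three] <;> ring

theorem matY_inv_smul (z : Kˣ) (u : Fin 3 → K) :
    (matY z)⁻¹ • u = ![u 1, z * (u 0 - u 2) + (z⁻¹ : K) * u 2, z * (u 0 - u 2)] := by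
  change ((matY z)⁻¹ : GL (Fin 3) K).val *ᵥ u = _
  ext i
  fin_cases i <;> simp [matY, Matrix.mulVec, dotProduct, Fin.sum_univ_three] <;> ring

variable (v : Valuation K Γ)

/-- The vectors whose direction is close to `(1, 0, 1)`. -/
def attracting : Set (Fin 3 → K) := {u | v (u 0 - u 2) < v (u 2) ∧ v (u 1) < v (u 2)}

/-- The vectors whose direction is close to `(0, 1, 1)`. -/
def repelling : Set (Fin 3 → K) := {u | v (u 0) < v (u 2) ∧ v (u 1 - u 2) < v (u 2)}

/-- The translates of the attracting and the repelling set by nontrivial powers of `matX l`. -/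
def translates (l : Kˣ) : Set (Fin 3 → K) :=
  {u | ∃ n : ℤ, n ≠ 0 ∧ matX (l ^ n) • u ∈ attracting v ∪ repelling v}

variable {v}

theorem val_eq_of_sub_lt {a c : K} (h : v (a - c) < v c) : v a = v c := by
  have := v.map_add_eq_of_lt_left h
  rwa [add_sub_cancel] at this

/-- In `m * (a - c) = (m * a - c) - (m - 1) * c` the last term dominates. -/
theorem val_sub_eq_of_mul_sub_lt {a c m : K} (hm : v m = 1) (hm1 : v (m - 1) = 1)
    (h : v (m * a - c) < v c) : v (a - c) = v c := by
  have h1 : v ((m - 1) * c) = v c := by rw [map_mul, hm1, one_mul]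
  have h2 : m * (a - c) = (m * a - c) - (m - 1) * c := by ring
  rw [← one_mul (v (a - c)), ← hm, ← map_mul, h2, v.map_sub_eq_of_lt_right (by rwa [h1]), h1]

theorem val_eq_one_of_zpow {l : Kˣ} (hl : v (l : K) = 1) (n : ℤ) :
    v ((l ^ n : Kˣ) : K) = 1 := by
  rw [Units.val_zpow_eq_zpow_val, map_zpow₀, hl, _root_.one_zpow]

/-- These estimates put the translates in the domain where both `matY z` and its inverse contract,
and separate them from both target sets. -/
theorem val_of_mem_translates {l : Kˣ} (hl : v (l : K) = 1)
    (hl1 : ∀ n : ℤ, n ≠ 0 → v ((l ^ n : Kˣ) - 1 : K) = 1) {u : Fin 3 → K}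
    (hu : u ∈ translates v l) :
    v (u 0) ≤ v (u 2) ∧ v (u 1) ≤ v (u 2) ∧ v (u 0 - u 2) = v (u 2) ∧ v (u 1 - u 2) = v (u 2) ∧
      0 < v (u 2) := by
  obtain ⟨n, hn, hu⟩ := hu
  have e (m : ℤ) (a : K) : v ((l ^ m : Kˣ) * a) = v a := by
    rw [map_mul, val_eq_one_of_zpow hl, one_mul]
  have hinv : (((l ^ n : Kˣ) : K)⁻¹) = ((l ^ (-n) : Kˣ) : K) := by simp
  simp only [attracting, repelling, matX_smul, hinv, Set.mem_union, Set.mem_ofPred_eq,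
    Matrix.cons_val_zero, Matrix.cons_val_one, Matrix.cons_val, e] at hu
  rcases hu with ⟨h0, h1⟩ | ⟨h0, h1⟩
  · refine ⟨?_, h1.le, ?_, v.map_sub_eq_of_lt_right h1, lt_of_le_of_lt zero_le h1⟩
    · rw [← val_eq_of_sub_lt h0, e]
    · exact val_sub_eq_of_mul_sub_lt (val_eq_one_of_zpow hl _) (hl1 _ (neg_ne_zero.mpr hn)) h0
  · refine ⟨h0.le, ?_, v.map_sub_eq_of_lt_right h0, ?_, lt_of_le_of_lt zero_le h0⟩
    · rw [← val_eq_of_sub_lt h1, e]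
    · exact val_sub_eq_of_mul_sub_lt (val_eq_one_of_zpow hl _) (hl1 _ hn) h1

theorem val_of_mem_attracting {u : Fin 3 → K} (hu : u ∈ attracting v) :
    v (u 0) = v (u 2) ∧ v (u 1 - u 2) = v (u 2) ∧ 0 < v (u 2) :=
  ⟨val_eq_of_sub_lt hu.1, v.map_sub_eq_of_lt_right hu.2, lt_of_le_of_lt zero_le hu.2⟩

theorem val_of_mem_repelling {u : Fin 3 → K} (hu : u ∈ repelling v) :
    v (u 1) = v (u 2) ∧ v (u 0 - u 2) = v (u 2) ∧ 0 < v (u 2) :=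
  ⟨val_eq_of_sub_lt hu.2, v.map_sub_eq_of_lt_right hu.1, lt_of_le_of_lt zero_le hu.1⟩

theorem val_inv_mul_lt {z : Kˣ} (hz : 1 < v (z : K)) {c : K} (hc : 0 < v c) :
    v ((z⁻¹ : K) * c) < v z * v c := by
  rw [map_mul, map_inv₀]
  exact mul_lt_mul_of_pos_right ((inv_lt_one_of_one_lt₀ hz).trans hz) hc

theorem lt_val_mul {z : Kˣ} (hz : 1 < v (z : K)) {a c : K} (hc : 0 < v c) (h : v a ≤ v c) :
    v a < v z * v c :=
  h.trans_lt (lt_mul_of_one_lt_left hc hz)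

/-- The dominant part of `matY z • u` is `z * (u 1 - u 2)` times `(1, 0, 1)`. -/
theorem matY_smul_mem_attracting {z : Kˣ} (hz : 1 < v (z : K)) {u : Fin 3 → K}
    (h0 : v (u 0) ≤ v (u 2)) (h1 : v (u 1 - u 2) = v (u 2)) (h2 : 0 < v (u 2)) :
    matY z • u ∈ attracting v := by
  simp only [attracting, matY_smul, Set.mem_ofPred_eq, Matrix.cons_val_zero, Matrix.cons_val_one,
    Matrix.cons_val, add_sub_cancel_left, map_mul v (z : K), h1]
  exact ⟨val_inv_mul_lt hz h2, lt_val_mul hz h2 h0⟩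

theorem matY_inv_smul_mem_repelling {z : Kˣ} (hz : 1 < v (z : K)) {u : Fin 3 → K}
    (h0 : v (u 1) ≤ v (u 2)) (h1 : v (u 0 - u 2) = v (u 2)) (h2 : 0 < v (u 2)) :
    (matY z)⁻¹ • u ∈ repelling v := by
  simp only [repelling, matY_inv_smul, Set.mem_ofPred_eq, Matrix.cons_val_zero, Matrix.cons_val_one,
    Matrix.cons_val, add_sub_cancel_left, map_mul v (z : K), h1]
  exact ⟨lt_val_mul hz h2 h0, val_inv_mul_lt hz h2⟩

theorem injective_lift_matX_matY {l z : Kˣ} (hl : v (l : K) = 1)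
    (hl1 : ∀ n : ℤ, n ≠ 0 → v ((l ^ n : Kˣ) - 1 : K) = 1) (hz : 1 < v (z : K)) :
    Function.Injective (FreeGroup.lift ![matX l, matY z]) := by
  have hpos (n : ℕ) {u : Fin 3 → K} (hu : u ∈ translates v l) :
      matY z ^ (n + 1) • u ∈ attracting v := by
    -- Only the first application starts in the translates; after it the attracting set is
    -- preserved.
    obtain ⟨h0, -, -, h1, h2⟩ := val_of_mem_translates hl hl1 hu
    induction n with
    | zero => simpa using matY_smul_mem_attracting hz h0 h1 h2
    | succ n ih =>
      rw [pow_succ', mul_smul]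
      obtain ⟨h0, h1, h2⟩ := val_of_mem_attracting ih
      exact matY_smul_mem_attracting hz h0.le h1 h2
  have hneg (n : ℕ) {u : Fin 3 → K} (hu : u ∈ translates v l) :
      (matY z)⁻¹ ^ (n + 1) • u ∈ repelling v := by
    obtain ⟨-, h0, h1, -, h2⟩ := val_of_mem_translates hl hl1 hu
    induction n with
    | zero => simpa using matY_inv_smul_mem_repelling hz h0 h1 h2
    | succ n ih =>
      rw [pow_succ', mul_smul]
      obtain ⟨h0, h1, h2⟩ := val_of_mem_repelling ih
      exact matY_inv_smul_mem_repelling hz h0.le h1 h2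
  have hX {n : ℤ} (hn : n ≠ 0) {u : Fin 3 → K} (hu : u ∈ attracting v ∪ repelling v) :
      matX l ^ n • u ∈ translates v l :=
    ⟨-n, neg_ne_zero.mpr hn, by rwa [← matX_zpow, smul_smul, ← _root_.zpow_add, neg_add_cancel,
      zpow_zero, one_smul]⟩
  have hmem : ![1, 0, 1] ∈ attracting v ∪ repelling v := Or.inl (by simp [attracting])
  have hdisj : Disjoint (translates v l) (attracting v ∪ repelling v) := by
    rw [Set.disjoint_left]
    rintro u hu (h | h)
    · exact h.1.ne (val_of_mem_translates hl hl1 hu).2.2.1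
    · exact h.2.ne (val_of_mem_translates hl hl1 hu).2.2.2.1
  refine FreeGroup.injective_lift_of_zpow_ping_pong _
    ![translates v l, attracting v ∪ repelling v] ?_ ?_ ?_
  · rw [Fin.forall_fin_two]
    exact ⟨⟨_, hX one_ne_zero hmem⟩, ⟨_, hmem⟩⟩
  · intro i j hij
    fin_cases i <;> fin_cases j
    · exact absurd rfl hij
    · exact hdisj
    · exact hdisj.symm
    · exact absurd rfl hij
  · intro i j hij n hn u hu
    fin_cases i <;> fin_cases j
    · exact absurd rfl hij
    · exact hX hn hu
    · change matY z ^ n • u ∈ attracting v ∪ repelling v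
      obtain ⟨m, rfl | rfl⟩ := n.eq_nat_or_neg
      · obtain ⟨k, rfl⟩ := Nat.exists_eq_succ_of_ne_zero (n := m) (by simpa using hn)
        exact Or.inl (by exact_mod_cast hpos k hu)
      · obtain ⟨k, rfl⟩ := Nat.exists_eq_succ_of_ne_zero (n := m) (by simpa using hn)
        rw [_root_.zpow_neg, ← _root_.inv_zpow]
        exact Or.inr (by exact_mod_cast hneg k hu)
    · exact absurd rfl hij

end PingPong

/-! ### Upper bound -/

/-- Over a field of rational functions in two variables, `G` has a faithful representation of
dimension three. -/
theorem hasFaithfulRepOfDim_three (k : Type u) [Field k] (p : ℕ) [CharP k p] :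
    HasFaithfulRepOfDim.{u, 0} p G 3 := by
  classical
  let l : (RatFunc (RatFunc k))ˣ := Units.mk0 (RatFunc.C RatFunc.X)
    (by simp [RatFunc.X_ne_zero])
  let z : (RatFunc (RatFunc k))ˣ := Units.mk0 RatFunc.X RatFunc.X_ne_zero
  have : CharP (RatFunc (RatFunc k)) p :=
    charP_of_injective_ringHom (f := RatFunc.C.comp RatFunc.C) (RingHom.injective _) p
  refine ⟨RatFunc (RatFunc k), inferInstance, this,
    repOf (matX l) (matY z) (matT l) (matT_mul_matX l) (matT_mul_matY l z),
    injective_of_injective_comp_inl _ ?_⟩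
  rw [repOf_comp_inl]
  -- The valuation is the degree in the outer variable `z`, so `l` and `l ^ n - 1` are nonzero
  -- constants of valuation 1.
  refine injective_lift_matX_matY (v := RatFunc.inftyValuation (RatFunc k)) ?_ ?_ ?_
  · exact RatFunc.inftyValuation.C _ RatFunc.X_ne_zero
  · intro n hn
    have hX : (RatFunc.X : RatFunc k) ^ n - 1 ≠ 0 := by
      intro h
      have := congrArg (RatFunc.inftyValuation k) (sub_eq_zero.mp h)
      rw [RatFunc.inftyValuation.X_zpow, map_one, ← WithZero.exp_zero,
        WithZero.exp_injective.eq_iff] at this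
      exact hn this
    have := RatFunc.inftyValuation.C (RatFunc k) hX
    simpa [l] using this
  · change 1 < RatFunc.inftyValuation (RatFunc k) RatFunc.X
    rw [RatFunc.inftyValuation.X, ← WithZero.exp_zero, WithZero.exp_lt_exp]
    exact zero_lt_one

theorem hasFaithfulRepOfDim_three_of_zero_or_prime (p : ℕ) (hp : p = 0 ∨ p.Prime) :
    HasFaithfulRepOfDim.{u, 0} p G 3 := by
  obtain rfl | hp := hp
  · exact hasFaithfulRepOfDim_three (ULift.{u} ℚ) 0
  · have := Fact.mk hp
    exact hasFaithfulRepOfDim_three (ULift.{u} (ZMod p)) p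

end FreeByCyclic

theorem mainTheorem12 (p : ℕ) (hp : p = 0 ∨ p.Prime) :
    3 ≤ minFaithfulDim.{u, 0} p FreeByCyclic.G ∧ minFaithfulDim.{u, 0} p FreeByCyclic.G ≤ 6 := by
  unfold minFaithfulDim
  refine ⟨le_sInf ?_, ?_⟩
  · rintro _ ⟨d, rfl, hd⟩
    exact_mod_cast FreeByCyclic.three_le_of_hasFaithfulRepOfDim hd
  · exact sInf_le_of_le ⟨3, rfl, FreeByCyclic.hasFaithfulRepOfDim_three_of_zero_or_prime p hp⟩
      (by norm_num)
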